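/- Let $C_1>0$ and $\delta>1$ be constants and let $(q_n)_{n\ge 1}$ be a real sequence with $q_n\to\infty$. There exist constants $\nu>0$ and $N$, depending only on $C_1$, $\delta$ and the sequence $(q_n)$, such that the following holds for every $n\ge N$, every $A_0\ge 10$ and every real $E_n>0$. Let $\mathbf E=[e_{ij}]$ be a random real $n\times n$ matrix such that either all its entries are independent, or $\mathbf E$ is symmetric and its entries $e_{ij}$ with $i\le j$ are independent. Suppose that all entries have mean zero and that $$q_n^{g'-2}\,\mathbb E\left|\frac{e_{ij}}{E_n}\right|^{g'}\le \frac{C_1^{g'}}{n}$$ for all $i,j\in\{1,\dots,n\}$ and all integers $g'$ with $2\le g'\le(\log n)^{A_0\log\log n}$ (these moments being finite). Then for every integer $g$ with $0\le g\le\log n$ and every vector $\boldsymbol u\in\mathbb R^n$ that is deterministic or, more generally, random and independent of $\mathbf E$, $$\max_{1\le i\le n}\left|\boldsymbol e_i^\top\mathbf E^g\boldsymbol u\right|\le 2E_n^g(\log n)^{\delta g}\|\boldsymbol u\|_{\max}$$ with probability at least $1-\exp\{-\nu(\log n)^\delta\}$. Here $\boldsymbol e_i$ is the $i$th standard basis vector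 and $\|\boldsymbol u\|_{\max}=\max_i|u_i|$. -/

import Mathlib

open MeasureTheory ProbabilityTheory Filter Matrix

/-! After dividing by `En`, the `k`-th absolute moments of the entries are at most `C ^ k / n`,
since eventually `q n ≥ 1`. The `p`-th moment of an entry of `E ^ g *ᵥ u` is a sum over `p` walks of
length `g` from `i`. These walks are revealed one step at a time (`WalkBound.succ`). A step to a
visited vertex has at most `V.card` choices. A step to a new vertex has at most `n` choices, but
uses an entry not seen before, whose moment supplies a factor `1 / n`. So a step costs at most
`V.card + 1`, and the moment is at most `(C * (p * g + 1)) ^ (p * g)`. Markov's inequality with `p *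
g` of order `(log n) ^ δ`, then a union bound over the `n` entries, finish the proof. -/

/-- A monomial in independent random variables is integrable as soon as each of its powers is, and
its expectation factorizes. -/
theorem iIndepFun.integrable_monomial {ι Ω : Type*} [Fintype ι] [MeasurableSpace Ω]
    {P : Measure Ω} [IsProbabilityMeasure P] {X : ι → Ω → ℝ} (hX : ∀ c, Measurable (X c))
    (hind : iIndepFun X P) (m : ι → ℕ) (hint : ∀ c, Integrable (fun ω => X c ω ^ m c) P) :
    Integrable (fun ω => ∏ c, X c ω ^ m c) P ∧
      ∫ ω, ∏ c, X c ω ^ m c ∂P = ∏ c, ∫ ω, X c ω ^ m c ∂P := by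
  have hX' : Measurable fun ω c => X c ω := measurable_pi_lambda _ hX
  refine ⟨?_, hind.integral_fun_prod_comp (f := fun c x => x ^ m c)
    (fun c => (hX c).aemeasurable) fun c => by fun_prop⟩
  have hmap := hind.map_fun_eq_pi_map fun c => (hX c).aemeasurable
  have hmeas : Measurable fun x : ι → ℝ => ∏ c, x c ^ m c := by fun_prop
  have key : Integrable (fun x : ι → ℝ => ∏ c, x c ^ m c) (P.map fun ω c => X c ω) := by
    rw [hmap]
    refine Integrable.fintype_prod (f := fun c (x : ℝ) => x ^ m c) fun c => ?_
    rw [integrable_map_measure (by fun_prop) (hX c).aemeasurable]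
    exact hint c
  exact (integrable_map_measure hmeas.aestronglyMeasurable hX'.aemeasurable).1 key

/-! ### Moments of monomials in sparse variables -/

/-- A family of centred independent random variables whose moments of order `k ∈ [2, K]` exist and
are at most `C ^ k * r`. -/
structure HasSparseMoments {ι Ω : Type*} [MeasurableSpace Ω] (P : Measure Ω) (X : ι → Ω → ℝ)
    (C r : ℝ) (K : ℕ) : Prop where
  measurable : ∀ c, Measurable (X c)
  indep : iIndepFun X P
  integrable : ∀ c, Integrable (X c) P
  integral_eq_zero : ∀ c, ∫ ω, X c ω ∂P = 0
  moment : ∀ c k, 2 ≤ k → k ≤ K →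
    Integrable (fun ω => |X c ω| ^ k) P ∧ ∫ ω, |X c ω| ^ k ∂P ≤ C ^ k * r

namespace HasSparseMoments

variable {ι Ω : Type*} [MeasurableSpace Ω] {P : Measure Ω}
  {X : ι → Ω → ℝ} {C r : ℝ} {K : ℕ}

theorem integrable_pow [IsProbabilityMeasure P]
    (h : HasSparseMoments P X C r K) (c : ι) {k : ℕ} (hk : k ≤ K) :
    Integrable (fun ω => X c ω ^ k) P := by
  obtain rfl | rfl | hk2 : k = 0 ∨ k = 1 ∨ 2 ≤ k := by omega
  · simp
  · simpa using h.integrable c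
  · refine (h.moment c k hk2 hk).1.mono' ((h.measurable c).pow_const k).aestronglyMeasurable ?_
    exact ae_of_all _ fun ω => by simp

/-- Zero mean lets the exponent `1` obey the same bound as exponents `≥ 2`, so each distinct
variable in a monomial yields one factor `r`. -/
theorem abs_integral_pow_le [IsProbabilityMeasure P]
    (h : HasSparseMoments P X C r K) (hC : 0 ≤ C) (hr : 0 ≤ r)
    (c : ι) {k : ℕ} (hk : k ≤ K) :
    |∫ ω, X c ω ^ k ∂P| ≤ C ^ k * (if k = 0 then 1 else r) := by
  obtain rfl | rfl | hk2 : k = 0 ∨ k = 1 ∨ 2 ≤ k := by omega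
  · simp
  · simp only [pow_one, h.integral_eq_zero c, abs_zero]
    positivity
  · rw [if_neg (by omega)]
    refine (abs_integral_le_integral_abs).trans ?_
    simpa only [abs_pow] using (h.moment c k hk2 hk).2

variable [Fintype ι]

theorem integrable_monomial [IsProbabilityMeasure P]
    (h : HasSparseMoments P X C r K) (m : ι → ℕ) (hm : ∑ c, m c ≤ K) :
    Integrable (fun ω => ∏ c, X c ω ^ m c) P :=
  (iIndepFun.integrable_monomial h.measurable h.indep m fun c =>
    h.integrable_pow c ((Finset.single_le_sum (fun _ _ => Nat.zero_le _)
      (Finset.mem_univ c)).trans hm)).1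

theorem abs_integral_monomial_le [IsProbabilityMeasure P]
    (h : HasSparseMoments P X C r K) (hC : 0 ≤ C) (hr : 0 ≤ r)
    (m : ι → ℕ) (hm : ∑ c, m c ≤ K) :
    |∫ ω, ∏ c, X c ω ^ m c ∂P| ≤
      C ^ (∑ c, m c) * r ^ (Finset.univ.filter fun c => m c ≠ 0).card := by
  have hle : ∀ c, m c ≤ K := fun c =>
    (Finset.single_le_sum (fun _ _ => Nat.zero_le _) (Finset.mem_univ c)).trans hm
  rw [(iIndepFun.integrable_monomial h.measurable h.indep m fun c =>
    h.integrable_pow c (hle c)).2, Finset.abs_prod]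
  refine (Finset.prod_le_prod (fun _ _ => abs_nonneg _) fun c _ =>
    h.abs_integral_pow_le hC hr c (hle c)).trans_eq ?_
  rw [Finset.prod_mul_distrib, Finset.prod_pow_eq_pow_sum, Finset.prod_ite]
  simp

/-! ### Step-by-step exploration of walks -/

variable {α : Type*} [Fintype α] [DecidableEq α]

/-- The bound on mixed moments of walks of lengths `t, g, …, g` (with `a` copies of `g`) that start
at `v, i, …, i`, given that the vertices in `V` have been visited before and that the monomial `m`
in the variables between them has been collected. -/
def WalkBound (P : Measure Ω) (X : ι → Ω → ℝ) (C r : ℝ) (K : ℕ) (cls : α → α → ι)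
    (u : Ω → α → ℝ) (g : ℕ) (i : α) (a t : ℕ) : Prop :=
  ∀ (v : α) (V : Finset α) (m : ι → ℕ) (φ : (α → ℝ) → ℝ), i ∈ V → v ∈ V →
    (∀ c, m c ≠ 0 → ∃ x ∈ V, ∃ y ∈ V, cls x y = c) → Measurable φ →
    (∀ ω, |φ (u ω)| ≤ 1) → ∑ c, m c + (t + a * g) ≤ K →
    Integrable (fun ω => (∏ c, X c ω ^ m c) * φ (u ω) *
      (((of fun x y => X (cls x y) ω) ^ t) *ᵥ u ω) v *
      (((of fun x y => X (cls x y) ω) ^ g) *ᵥ u ω) i ^ a) P ∧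
    |∫ ω, (∏ c, X c ω ^ m c) * φ (u ω) *
      (((of fun x y => X (cls x y) ω) ^ t) *ᵥ u ω) v *
      (((of fun x y => X (cls x y) ω) ^ g) *ᵥ u ω) i ^ a ∂P| ≤
    C ^ (∑ c, m c + (t + a * g)) * r ^ (Finset.univ.filter fun c => m c ≠ 0).card *
      ((V.card + 1).ascFactorial (t + a * g) : ℕ)

theorem walkBound_zero_zero [IsProbabilityMeasure P]
    (h : HasSparseMoments P X C r K) (hC : 0 ≤ C) (hr : 0 ≤ r)
    (cls : α → α → ι) (u : Ω → α → ℝ) (hu : Measurable u) (hu1 : ∀ ω v, |u ω v| ≤ 1)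
    (hindep : IndepFun (fun ω c => X c ω) u P) (g : ℕ) (i : α) :
    WalkBound P X C r K cls u g i 0 0 := by
  intro v V m φ _ _ _ hφ hφ1 hmK
  simp only [zero_mul, add_zero, pow_zero, one_mulVec, mul_one, Nat.ascFactorial_zero,
    Nat.cast_one, mul_assoc] at hmK ⊢
  have hψ1 : ∀ ω, |φ (u ω) * u ω v| ≤ 1 := fun ω => by
    rw [abs_mul]
    exact mul_le_one₀ (hφ1 ω) (abs_nonneg _) (hu1 ω v)
  have hψm : Measurable fun ω => φ (u ω) * u ω v := by fun_prop
  have hψi : Integrable (fun ω => φ (u ω) * u ω v) P :=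
    Integrable.of_bound hψm.aestronglyMeasurable 1 (ae_of_all _ hψ1)
  have hind : IndepFun (fun ω => ∏ c, X c ω ^ m c) (fun ω => φ (u ω) * u ω v) P :=
    hindep.comp (φ := fun x : ι → ℝ => ∏ c, x c ^ m c) (ψ := fun w : α → ℝ => φ w * w v)
      (by fun_prop) (by fun_prop)
  have hXi := h.integrable_monomial m hmK
  refine ⟨hind.integrable_mul hXi hψi, ?_⟩
  rw [hind.integral_fun_mul_eq_mul_integral hXi.aestronglyMeasurable hψm.aestronglyMeasurable,
    abs_mul]
  refine (mul_le_of_le_one_right (abs_nonneg _) ?_).trans (h.abs_integral_monomial_le hC hr m hmK)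
  have := norm_integral_le_of_norm_le_const (μ := P) (C := 1)
    (f := fun ω => φ (u ω) * u ω v) (ae_of_all _ hψ1)
  simpa using this

/-- A finished walk leaves the factor `u v`, which is absorbed into `φ`; the next copy then starts
afresh at `i`. -/
theorem WalkBound.succ_zero {cls : α → α → ι} {u : Ω → α → ℝ} (hu1 : ∀ ω v, |u ω v| ≤ 1)
    {g : ℕ} {i : α} {a : ℕ} (h : WalkBound P X C r K cls u g i a g) :
    WalkBound P X C r K cls u g i (a + 1) 0 := by
  intro v V m φ hi hv hm hφ hφ1 hmK
  have e : 0 + (a + 1) * g = g + a * g := by ring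
  rw [e] at hmK ⊢
  have := h i V m (fun w => φ w * w v) hi hi hm (by fun_prop) (fun ω => by
    rw [abs_mul]
    exact mul_le_one₀ (hφ1 ω) (abs_nonneg _) (hu1 ω v)) hmK
  simpa only [pow_zero, one_mulVec, pow_succ', mul_assoc] using this

theorem WalkBound.succ [DecidableEq ι] (hC : 0 ≤ C) (hr : 0 ≤ r)
    (hcard : Fintype.card α * r ≤ 1) {cls : α → α → ι}
    (hcls : ∀ a b c d, cls a b = cls c d → b = c ∨ b = d) {u : Ω → α → ℝ}
    {g : ℕ} {i : α} {a t : ℕ} (h : WalkBound P X C r K cls u g i a t) :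
    WalkBound P X C r K cls u g i a (t + 1) := by
  intro v V m φ hi hv hm hφ hφ1 hmK
  set F : α → Ω → ℝ := fun w ω => (∏ c, X c ω ^ (m + Pi.single (cls v w) 1 : ι → ℕ) c) * φ (u ω) *
    (((of fun x y => X (cls x y) ω) ^ t) *ᵥ u ω) w *
    (((of fun x y => X (cls x y) ω) ^ g) *ᵥ u ω) i ^ a with hF
  have hsplit : (fun ω => (∏ c, X c ω ^ m c) * φ (u ω) *
      (((of fun x y => X (cls x y) ω) ^ (t + 1)) *ᵥ u ω) v *
      (((of fun x y => X (cls x y) ω) ^ g) *ᵥ u ω) i ^ a) = fun ω => ∑ w, F w ω := by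
    funext ω
    rw [pow_succ', ← mulVec_mulVec]
    conv_lhs => enter [1, 2]; rw [mulVec, dotProduct]
    rw [Finset.mul_sum, Finset.sum_mul]
    refine Finset.sum_congr rfl fun w _ => ?_
    simp only [hF, Pi.add_apply, pow_add, Finset.prod_mul_distrib, of_apply]
    rw [Fintype.prod_eq_single (f := fun c => X c ω ^ (Pi.single (cls v w) 1 : ι → ℕ) c) (cls v w)
      fun c hc => by simp [hc]]
    simp only [Pi.single_eq_same, pow_one]
    ring
  have hsum : ∀ w, ∑ c, (m + Pi.single (cls v w) 1 : ι → ℕ) c = ∑ c, m c + 1 := fun w => by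
    simp [Finset.sum_add_distrib]
  have hsupp : ∀ w, (Finset.univ.filter fun c => (m + Pi.single (cls v w) 1 : ι → ℕ) c ≠ 0) =
      insert (cls v w) (Finset.univ.filter fun c => m c ≠ 0) := fun w => by
    ext c
    by_cases hc : c = cls v w
    · simp [hc]
    · simp [hc]
  have hm' : ∀ w (V' : Finset α), V ⊆ V' → w ∈ V' →
      ∀ c, (m + Pi.single (cls v w) 1 : ι → ℕ) c ≠ 0 → ∃ x ∈ V', ∃ y ∈ V', cls x y = c := by
    intro w V' hV hw c hc
    by_cases hcw : c = cls v w
    · exact ⟨v, hV hv, w, hw, hcw.symm⟩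
    · obtain ⟨x, hx, y, hy, hxy⟩ := hm c (by simpa [hcw] using hc)
      exact ⟨x, hV hx, y, hV hy, hxy⟩
  have e : ∀ k, k + 1 + (t + a * g) = k + (t + 1 + a * g) := fun k => by ring
  have e1 : t + 1 + a * g = (t + a * g) + 1 := by ring
  set B : ℝ := C ^ (∑ c, m c + (t + 1 + a * g)) *
    r ^ (Finset.univ.filter fun c => m c ≠ 0).card *
    ((V.card + 2).ascFactorial (t + a * g) : ℕ) with hB
  have hB0 : 0 ≤ B := by positivity
  have hr1 : r ≤ 1 := by
    have : (1 : ℝ) ≤ Fintype.card α := by exact_mod_cast Fintype.card_pos_iff.2 ⟨v⟩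
    nlinarith
  -- The variable may already be present, so no gain in `r` is claimed; `V` does not grow.
  have hold : ∀ w ∈ V, Integrable (F w) P ∧ |∫ ω, F w ω ∂P| ≤ B := by
    intro w hw
    obtain ⟨h1, h2⟩ := h w V _ φ hi hw (hm' w V subset_rfl hw) hφ hφ1 (by rw [hsum, e]; exact hmK)
    refine ⟨h1, h2.trans ?_⟩
    rw [hsum, e, hsupp, hB]
    gcongr ?_ * ?_ * ?_
    · exact pow_le_pow_of_le_one hr hr1 (Finset.card_le_card (Finset.subset_insert _ _))
    · exact_mod_cast Nat.ascFactorial_le _ (by omega)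
  -- By `hcls`, a variable on an edge ending outside `V` cannot occur in `m`, so the support grows
  -- by one and gains a factor `r`.
  have hnew : ∀ w ∉ V, Integrable (F w) P ∧ |∫ ω, F w ω ∂P| ≤ r * B := by
    intro w hw
    obtain ⟨h1, h2⟩ := h w (insert w V) _ φ (by simp [hi]) (by simp)
      (hm' w _ (Finset.subset_insert _ _) (by simp)) hφ hφ1 (by rw [hsum, e]; exact hmK)
    refine ⟨h1, h2.trans_eq ?_⟩
    rw [hsum, e, hsupp, hB, Finset.card_insert_of_notMem, Finset.card_insert_of_notMem hw, pow_succ]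
    · ring
    · simp only [Finset.mem_filter, Finset.mem_univ, true_and, not_not]
      by_contra hne
      obtain ⟨x, hx, y, hy, hxy⟩ := hm _ hne
      rcases hcls _ _ _ _ hxy.symm with rfl | rfl
      · exact hw hx
      · exact hw hy
  have hint : ∀ w, Integrable (F w) P := fun w => by
    by_cases hw : w ∈ V
    exacts [(hold w hw).1, (hnew w hw).1]
  rw [hsplit]
  refine ⟨integrable_finsetSum _ fun w _ => hint w, ?_⟩
  rw [integral_finsetSum _ fun w _ => hint w]
  calc |∑ w, ∫ ω, F w ω ∂P| ≤ ∑ w, |∫ ω, F w ω ∂P| := Finset.abs_sum_le_sum_abs _ _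
    _ ≤ ∑ w, ((if w ∈ V then B else 0) + r * B) := by
        refine Finset.sum_le_sum fun w _ => ?_
        split_ifs with hw
        · exact (hold w hw).2.trans (le_add_of_nonneg_right (by positivity))
        · simpa using (hnew w hw).2
    _ = (V.card + Fintype.card α * r) * B := by
        simp [Finset.sum_add_distrib, Finset.sum_ite_mem]
        ring
    _ ≤ (V.card + 1) * B := by gcongr
    _ = _ := by
        rw [e1, hB, Nat.ascFactorial_succ, ← Nat.succ_ascFactorial, e1]
        push_cast
        ring

theorem walkBound [DecidableEq ι] [IsProbabilityMeasure P]
    (h : HasSparseMoments P X C r K) (hC : 0 ≤ C)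
    (hr : 0 ≤ r) (hcard : Fintype.card α * r ≤ 1) (cls : α → α → ι)
    (hcls : ∀ a b c d, cls a b = cls c d → b = c ∨ b = d)
    (u : Ω → α → ℝ) (hu : Measurable u) (hu1 : ∀ ω v, |u ω v| ≤ 1)
    (hindep : IndepFun (fun ω c => X c ω) u P) (g : ℕ) (i : α) (a t : ℕ) :
    WalkBound P X C r K cls u g i a t := by
  have step : ∀ a, WalkBound P X C r K cls u g i a 0 → ∀ t, WalkBound P X C r K cls u g i a t := by
    intro a h0 t
    induction t with
    | zero => exact h0
    | succ t ih => exact ih.succ hC hr hcard hcls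
  induction a generalizing t with
  | zero => exact step 0 (h.walkBound_zero_zero hC hr cls u hu hu1 hindep g i) t
  | succ a ih => exact step _ ((ih g).succ_zero hu1) t

/-- High moments of the entries of `H ^ g *ᵥ u`, for `H` built from sparse independent variables. -/
theorem integral_pow_mulVec_le [DecidableEq ι] [IsProbabilityMeasure P]
    (h : HasSparseMoments P X C r K) (hC : 0 ≤ C)
    (hr : 0 ≤ r) (hcard : Fintype.card α * r ≤ 1) (cls : α → α → ι)
    (hcls : ∀ a b c d, cls a b = cls c d → b = c ∨ b = d)
    (u : Ω → α → ℝ) (hu : Measurable u) (hu1 : ∀ ω v, |u ω v| ≤ 1)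
    (hindep : IndepFun (fun ω c => X c ω) u P) (g p : ℕ) (hp : p ≠ 0) (hpK : p * g ≤ K) (i : α) :
    Integrable (fun ω => (((of fun x y => X (cls x y) ω) ^ g) *ᵥ u ω) i ^ p) P ∧
    ∫ ω, (((of fun x y => X (cls x y) ω) ^ g) *ᵥ u ω) i ^ p ∂P ≤
      (C * (p * g + 1)) ^ (p * g) := by
  obtain ⟨a, rfl⟩ := Nat.exists_eq_succ_of_ne_zero hp
  have e : g + a * g = (a + 1) * g := by ring
  obtain ⟨h1, h2⟩ := h.walkBound hC hr hcard cls hcls u hu hu1 hindep g i a g i {i} 0 (fun _ => 1)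
    (by simp) (by simp) (by simp) measurable_const (by simp) (by simpa [e] using hpK)
  simp only [Pi.zero_apply, pow_zero, Finset.prod_const_one, one_mul, ← pow_succ', e,
    Finset.sum_const_zero, zero_add, ne_eq, not_true_eq_false, Finset.filter_false,
    Finset.card_empty, mul_one, Finset.card_singleton] at h1 h2
  refine ⟨h1, (le_abs_self _).trans (h2.trans ?_)⟩
  rw [mul_pow]
  gcongr
  norm_cast
  have := Nat.ascFactorial_le_pow_add 1 ((a + 1) * g)
  simpa [add_comm] using this

end HasSparseMoments

/-! ### Tail bounds -/

/-- Exponential tail bound for a single entry, by Markov's inequality for the `p`-th moment. -/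
theorem HasSparseMoments.measureReal_lt_abs_mulVec_le {ι α Ω : Type*} [MeasurableSpace Ω]
    {P : Measure Ω} [IsProbabilityMeasure P] {X : ι → Ω → ℝ} {C r : ℝ} {K : ℕ} [Fintype ι]
    [Fintype α] [DecidableEq α] [DecidableEq ι] (h : HasSparseMoments P X C r K) (hC : 0 ≤ C)
    (hr : 0 ≤ r) (hcard : Fintype.card α * r ≤ 1) (cls : α → α → ι)
    (hcls : ∀ a b c d, cls a b = cls c d → b = c ∨ b = d)
    (u : Ω → α → ℝ) (hu : Measurable u) (hu1 : ∀ ω v, |u ω v| ≤ 1)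
    (hindep : IndepFun (fun ω c => X c ω) u P) (g p : ℕ) (hp : p ≠ 0) (hpe : Even p)
    (hpK : p * g ≤ K) {L : ℝ} (hL : 0 < L) (hCL : Real.exp 1 * (C * (p * g + 1)) ≤ L) (i : α) :
    P.real {ω | L ^ g < |(((of fun x y => X (cls x y) ω) ^ g) *ᵥ u ω) i|} ≤
      Real.exp (-(p * g)) := by
  obtain ⟨hint, hle⟩ := h.integral_pow_mulVec_le hC hr hcard cls hcls u hu hu1 hindep g p hp hpK i
  have hmarkov := mul_meas_ge_le_integral_of_nonneg (ae_of_all P fun ω => hpe.pow_nonneg _)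
    hint (L ^ (p * g))
  have hsub : P.real {ω | L ^ g < |(((of fun x y => X (cls x y) ω) ^ g) *ᵥ u ω) i|} ≤
      P.real {ω | L ^ (p * g) ≤ (((of fun x y => X (cls x y) ω) ^ g) *ᵥ u ω) i ^ p} := by
    refine measureReal_mono fun ω hω => ?_
    simp only [Set.mem_ofPred_eq] at hω ⊢
    rw [← hpe.pow_abs, mul_comm p g, pow_mul]
    exact pow_le_pow_left₀ (by positivity) hω.le p
  refine hsub.trans (le_of_mul_le_mul_left (hmarkov.trans (hle.trans ?_))
    (pow_pos hL (p * g)))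
  have hexp : Real.exp (-(p * g)) = (Real.exp 1 ^ (p * g))⁻¹ := by
    rw [← Real.exp_nat_mul, Real.exp_neg]
    simp
  rw [hexp, ← div_eq_mul_inv, ← div_pow]
  refine pow_le_pow_left₀ (by positivity) ?_ _
  rw [le_div_iff₀ (Real.exp_pos 1)]
  linarith

theorem one_sub_le_measureReal_iSup_mulVec_le_of_hasSparseMoments {ι Ω : Type*} {n : ℕ}
    [MeasurableSpace Ω] {P : Measure Ω} [IsProbabilityMeasure P] {X : ι → Ω → ℝ} {C : ℝ} {K : ℕ}
    [Fintype ι] [DecidableEq ι] (h : HasSparseMoments P X C (n : ℝ)⁻¹ K) (hC : 0 ≤ C)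
    (cls : Fin n → Fin n → ι) (hcls : ∀ a b c d, cls a b = cls c d → b = c ∨ b = d)
    {E : Ω → Matrix (Fin n) (Fin n) ℝ} {s : ℝ} (hs : 0 < s)
    (hE : ∀ᵐ ω ∂P, E ω = s • of fun x y => X (cls x y) ω)
    (u : Ω → Fin n → ℝ) (hu : Measurable u)
    (hindep : IndepFun (fun ω c => X c ω) u P) (g p : ℕ) (hp : p ≠ 0) (hpe : Even p)
    (hpK : p * g ≤ K) {L : ℝ} (hL : 0 < L) (hCL : Real.exp 1 * (C * (p * g + 1)) ≤ L) :
    1 - n * Real.exp (-(p * g)) ≤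
      P.real {ω | (⨆ i : Fin n, |((E ω ^ g) *ᵥ u ω) i|) ≤ s ^ g * L ^ g * ‖u ω‖} := by
  -- Normalizing keeps independence from `X`; where `u ω = 0`, the convention `0⁻¹ = 0` gives `w ω =
  -- 0`.
  set w : Ω → Fin n → ℝ := fun ω => ‖u ω‖⁻¹ • u ω with hw
  have hwm : Measurable fun x : Fin n → ℝ => ‖x‖⁻¹ • x := by fun_prop
  have hw1 : ∀ ω v, |w ω v| ≤ 1 := fun ω v => by
    simp only [hw, Pi.smul_apply, smul_eq_mul, abs_mul, abs_inv, abs_norm]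
    rw [inv_mul_eq_div]
    exact div_le_one_of_le₀ (norm_le_pi_norm (u ω) v) (norm_nonneg _)
  have hwu : ∀ ω, u ω = ‖u ω‖ • w ω := fun ω => by
    by_cases h0 : u ω = 0
    · simp [hw, h0]
    · simp [hw, smul_smul, h0]
  have hwind : IndepFun (fun ω c => X c ω) w P := hindep.comp measurable_id hwm
  have hcard : (Fintype.card (Fin n) : ℝ) * (n : ℝ)⁻¹ ≤ 1 := by
    simpa using mul_inv_le_one
  set S : Set Ω := {ω | (⨆ i : Fin n, |((E ω ^ g) *ᵥ u ω) i|) ≤ s ^ g * L ^ g * ‖u ω‖}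
  set T : Fin n → Set Ω := fun i =>
    {ω | L ^ g < |(((of fun x y => X (cls x y) ω) ^ g) *ᵥ w ω) i|} with hT
  have hST : ∀ᵐ ω ∂P, ω ∈ Sᶜ → ω ∈ ⋃ i, T i := by
    filter_upwards [hE] with ω hω
    contrapose!
    intro hωT
    simp only [hT, Set.mem_iUnion, Set.mem_ofPred_eq, not_exists, not_lt] at hωT
    rw [Set.notMem_compl_iff]
    refine Real.iSup_le (fun i => ?_) (by positivity)
    rw [hω, smul_pow, hwu ω, mulVec_smul, smul_mulVec, norm_smul, norm_norm]
    simp only [Pi.smul_apply, smul_eq_mul, abs_mul, abs_norm, abs_pow, abs_of_pos hs]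
    have : ‖u ω‖ * ‖w ω‖ = ‖u ω‖ := by
      conv_rhs => rw [hwu ω, norm_smul, norm_norm]
    rw [this]
    calc _ ≤ ‖u ω‖ * (s ^ g * L ^ g) := by gcongr; exact hωT i
      _ = _ := by ring
  have hSc : P.real Sᶜ ≤ n * Real.exp (-(p * g)) :=
    calc P.real Sᶜ ≤ P.real (⋃ i, T i) :=
          ENNReal.toReal_mono (measure_ne_top _ _) (measure_mono_ae hST)
      _ ≤ ∑ i, P.real (T i) := measureReal_iUnion_fintype_le _
      _ ≤ ∑ _i : Fin n, Real.exp (-(p * g)) := Finset.sum_le_sum fun i _ =>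
          h.measureReal_lt_abs_mulVec_le hC (by positivity) hcard cls hcls w (hwm.comp hu) hw1
            hwind g p hp hpe hpK hL hCL i
      _ = _ := by simp
  -- Subadditivity suffices here, so `S` need not be shown measurable.
  have huniv : 1 ≤ P.real S + P.real Sᶜ := by
    have := measureReal_union_le (μ := P) S Sᶜ
    rwa [Set.union_compl_self, probReal_univ] at this
  linarith

/-- Tail bound for the largest entry of `E ^ g *ᵥ u`, for a random matrix with independent entries or
a symmetric one with independent entries on and above the diagonal. -/
theorem one_sub_le_measureReal_iSup_mulVec_le {Ω : Type*} {n : ℕ}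
    [MeasurableSpace Ω] {P : Measure Ω} [IsProbabilityMeasure P] {C : ℝ} {K : ℕ} (hC : 0 ≤ C)
    {E : Ω → Matrix (Fin n) (Fin n) ℝ} {s : ℝ} (hs : 0 < s)
    (hmeas : ∀ i j, Measurable fun ω => E ω i j)
    (hE : iIndepFun (fun (p : Fin n × Fin n) ω => E ω p.1 p.2) P ∨
      ((∀ᵐ ω ∂P, (E ω).IsSymm) ∧
        iIndepFun (fun (p : {p : Fin n × Fin n // p.1 ≤ p.2}) ω => E ω p.1.1 p.1.2) P))
    (hmean : ∀ i j, Integrable (fun ω => E ω i j) P ∧ ∫ ω, E ω i j ∂P = 0)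
    (hmom : ∀ i j, ∀ k : ℕ, 2 ≤ k → k ≤ K →
      Integrable (fun ω => |E ω i j / s| ^ k) P ∧
        ∫ ω, |E ω i j / s| ^ k ∂P ≤ C ^ k * (n : ℝ)⁻¹)
    (u : Ω → Fin n → ℝ) (hu : Measurable u)
    (hindep : IndepFun (fun ω (p : Fin n × Fin n) => E ω p.1 p.2) u P)
    (g p : ℕ) (hp : p ≠ 0) (hpe : Even p)
    (hpK : p * g ≤ K) {L : ℝ} (hL : 0 < L) (hCL : Real.exp 1 * (C * (p * g + 1)) ≤ L) :
    1 - n * Real.exp (-(p * g)) ≤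
      P.real {ω | (⨆ i : Fin n, |((E ω ^ g) *ᵥ u ω) i|) ≤ s ^ g * L ^ g * ‖u ω‖} := by
  have hdiv : Measurable fun x : ℝ => x / s := by fun_prop
  have hmean' : ∀ i j, ∫ ω, E ω i j / s ∂P = 0 := fun i j => by
    rw [integral_div, (hmean i j).2, zero_div]
  rcases hE with hE | ⟨hsymm, hE⟩
  · have h : HasSparseMoments P (fun (p : Fin n × Fin n) ω => E ω p.1 p.2 / s) C (n : ℝ)⁻¹ K :=
      ⟨fun _ => (hmeas _ _).div_const s, hE.comp (fun _ x => x / s) fun _ => hdiv,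
        fun _ => (hmean _ _).1.div_const s, fun _ => hmean' _ _, fun _ => hmom _ _⟩
    refine one_sub_le_measureReal_iSup_mulVec_le_of_hasSparseMoments h hC Prod.mk ?_ hs ?_ u hu
      (hindep.comp (φ := fun x p => x p / s) (by fun_prop) measurable_id)
      g p hp hpe hpK hL hCL
    · rintro a b c d hab
      exact Or.inr (Prod.ext_iff.1 hab).2
    · refine ae_of_all _ fun ω => ?_
      ext i j
      simp [mul_div_cancel₀ _ hs.ne']
  · have h : HasSparseMoments P (fun (p : {p : Fin n × Fin n // p.1 ≤ p.2}) ω =>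
        E ω p.1.1 p.1.2 / s) C (n : ℝ)⁻¹ K :=
      ⟨fun _ => (hmeas _ _).div_const s, hE.comp (fun _ x => x / s) fun _ => hdiv,
        fun _ => (hmean _ _).1.div_const s, fun _ => hmean' _ _, fun _ => hmom _ _⟩
    refine one_sub_le_measureReal_iSup_mulVec_le_of_hasSparseMoments h hC
      -- Symmetric positions share one variable, indexed by the sorted pair.
      (fun i j => ⟨(min i j, max i j), min_le_max⟩) ?_ hs ?_ u hu
      (hindep.comp (φ := fun (x : Fin n × Fin n → ℝ)
        (p : {p : Fin n × Fin n // p.1 ≤ p.2}) => x p.1 / s)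
        (by fun_prop) measurable_id) g p hp hpe hpK hL hCL
    · intro a b c d hab
      simp only [Subtype.mk.injEq, Prod.mk.injEq] at hab
      grind
    · filter_upwards [hsymm] with ω hω
      ext i j
      rcases le_total i j with hij | hij
      · simp [hij, mul_div_cancel₀ _ hs.ne']
      · simp [hij, mul_div_cancel₀ _ hs.ne', hω.apply i j]

/-! ### Choice of parameters -/

theorem proposition2
    (C₁ δ : ℝ) (hC₁ : 0 < C₁) (hδ : 1 < δ)
    (q : ℕ → ℝ) (hq : Tendsto q atTop atTop) :
    ∃ ν : ℝ, 0 < ν ∧ ∃ N : ℕ, ∀ n : ℕ, N ≤ n →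
      ∀ (A₀ : ℝ), 10 ≤ A₀ → ∀ (En : ℝ), 0 < En →
      ∀ (Ω : Type*) [MeasurableSpace Ω] (P : Measure Ω) [IsProbabilityMeasure P]
        (E : Ω → Matrix (Fin n) (Fin n) ℝ),
        -- the entries are random variables, either all of them are independent, or `E` is
        -- symmetric and the entries on and above the diagonal are independent
        (∀ i j, Measurable fun ω => E ω i j) →
        (iIndepFun (fun (p : Fin n × Fin n) ω => E ω p.1 p.2) P ∨
          ((∀ᵐ ω ∂P, (E ω).IsSymm) ∧
            iIndepFun (fun (p : {p : Fin n × Fin n // p.1 ≤ p.2}) ω => E ω p.1.1 p.1.2) P)) →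
        -- zero mean
        (∀ i j, Integrable (fun ω => E ω i j) P ∧ ∫ ω, E ω i j ∂P = 0) →
        -- moment bounds (in particular these moments are finite)
        (∀ i j, ∀ k : ℕ, 2 ≤ k →
          (k : ℝ) ≤ (Real.log n) ^ (A₀ * Real.log (Real.log n)) →
          Integrable (fun ω => |E ω i j / En| ^ k) P ∧
            q n ^ (k - 2) * ∫ ω, |E ω i j / En| ^ k ∂P ≤ C₁ ^ k * (n : ℝ)⁻¹) →
        ∀ g : ℕ, (g : ℝ) ≤ Real.log n →
        -- `u` is a random (for instance deterministic) vector independent of `E`;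
        -- `‖u ω‖` is its largest entry in absolute value
        ∀ u : Ω → Fin n → ℝ, Measurable u →
          IndepFun (fun ω (p : Fin n × Fin n) => E ω p.1 p.2) u P →
          1 - Real.exp (-ν * (Real.log n) ^ δ) ≤
            P.real {ω | (⨆ i : Fin n, |((E ω ^ g) *ᵥ u ω) i|) ≤
              2 * En ^ g * (Real.log n) ^ (δ * g) * ‖u ω‖} := by
  set C : ℝ := max C₁ 1 with hCdef
  have hC1 : 1 ≤ C := le_max_right _ _
  set D : ℝ := 4 * Real.exp 1 * C with hD
  have he : (1 : ℝ) ≤ Real.exp 1 := Real.one_le_exp zero_le_one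
  have hDe : 4 * (Real.exp 1 * C) = D := by rw [hD]; ring
  have hD4 : 4 ≤ D := by nlinarith
  have hlog : Tendsto (fun n : ℕ => Real.log n) atTop atTop :=
    Real.tendsto_log_atTop.comp tendsto_natCast_atTop_atTop
  have hrpow : ∀ᶠ x : ℝ in atTop, 3 * D ≤ x ^ (δ - 1) :=
    (tendsto_rpow_atTop (by linarith)).eventually_ge_atTop _
  obtain ⟨N, hN⟩ := eventually_atTop.1 ((hq.eventually_ge_atTop 1).and
    ((hlog.eventually hrpow).and ((hlog.eventually_ge_atTop 1).and
      (((Real.tendsto_log_atTop.comp hlog).eventually_ge_atTop δ).and (eventually_gt_atTop 0)))))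
  refine ⟨1 / D, by positivity, N, fun n hn A₀ hA₀ En hEn Ω _ P _ E hmeas hE hmean hmom g hg
    u hu hindep => ?_⟩
  obtain ⟨hqn, hxD, hx1, hxδ, hn0⟩ := hN n hn
  simp only [Function.comp_apply] at hxδ
  set x : ℝ := Real.log n with hx
  set L : ℝ := x ^ δ with hL
  have hx0 : 0 < x := by linarith
  have hL0 : 0 < L := Real.rpow_pos_of_pos hx0 _
  have hLx : 3 * D * x ≤ L := by
    have : L = x ^ (δ - 1) * x := by
      rw [hL, ← Real.rpow_add_one hx0.ne', sub_add_cancel]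
    rw [this]
    gcongr
  have hLg : x ^ (δ * g) = L ^ g := by rw [hL, Real.rpow_mul hx0.le, Real.rpow_natCast]
  rw [hLg]
  -- For `g = 0` the moment method gives no decay, but the bound holds surely.
  rcases Nat.eq_zero_or_pos g with rfl | hg0
  · have : {ω | (⨆ i : Fin n, |((E ω ^ 0) *ᵥ u ω) i|) ≤ 2 * En ^ 0 * L ^ 0 * ‖u ω‖} =
        Set.univ := by
      refine Set.eq_univ_of_forall fun ω => Real.iSup_le (fun i => ?_) (by positivity)
      have := norm_le_pi_norm (u ω) i
      simp only [pow_zero, one_mulVec, Real.norm_eq_abs] at this ⊢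
      linarith [norm_nonneg (u ω)]
    rw [this, probReal_univ]
    linarith [Real.exp_pos (-(1 / D) * L)]
  have hg1 : (1 : ℝ) ≤ g := by exact_mod_cast hg0
  -- The moment order is `2 * f`, even for Markov, with `2 * f * g` within `2 * g` of `2 * L / D`.
  set f : ℕ := ⌊L / (D * g)⌋₊ with hf
  have hfle : f * g ≤ L / D := by
    have := Nat.floor_le (show 0 ≤ L / (D * g) by positivity)
    rw [← hf, ← div_div, le_div_iff₀ (by positivity)] at this
    exact this
  have hfge : L / D - g ≤ f * g := by
    have := Nat.lt_floor_add_one (L / (D * g))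
    rw [← hf, ← div_div, div_lt_iff₀ (by positivity)] at this
    linarith
  have hLD : 3 * x ≤ L / D := by
    rw [le_div_iff₀ (by positivity)]
    linarith
  have hf0 : f ≠ 0 := by
    rintro h0
    rw [h0, Nat.cast_zero] at hfge
    linarith
  have hLD4 : L / D ≤ L / 4 := by gcongr
  have hpow : L ≤ x ^ (A₀ * Real.log x) := by
    refine Real.rpow_le_rpow_of_exponent_le hx1 ?_
    nlinarith
  have hmain := one_sub_le_measureReal_iSup_mulVec_le (P := P) (C := C)
    (K := ⌊x ^ (A₀ * Real.log x)⌋₊) (by positivity) hEn hmeas hE hmean ?_ u hu hindep g (2 * f)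
    (by omega) (even_two_mul f) ?_ hL0 ?_
  · refine le_trans ?_ (hmain.trans (measureReal_mono ?_))
    -- The exponent is `x - 2 * f * g ≤ x + 2 * g - 2 * L / D ≤ -L / D`, using `g ≤ x` and `3 * x ≤
    -- L / D`.
    · have hnexp : (n : ℝ) = Real.exp x := (Real.exp_log (by exact_mod_cast hn0)).symm
      rw [hnexp, ← Real.exp_add]
      gcongr
      push_cast
      have : -(1 / D) * L = -(L / D) := by ring
      rw [this]
      linarith
    · intro ω hω
      refine le_trans (Set.mem_ofPred_eq ▸ hω) ?_
      have : 0 ≤ En ^ g * L ^ g * ‖u ω‖ := by positivity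
      linarith
  · intro i j k hk hkK
    have hkx : (k : ℝ) ≤ x ^ (A₀ * Real.log x) :=
      (Nat.le_floor_iff (by positivity)).1 hkK
    obtain ⟨h1, h2⟩ := hmom i j k hk hkx
    refine ⟨h1, ?_⟩
    calc _ ≤ q n ^ (k - 2) * ∫ ω, |E ω i j / En| ^ k ∂P :=
          le_mul_of_one_le_left (integral_nonneg fun ω => by positivity) (one_le_pow₀ hqn)
      _ ≤ C₁ ^ k * (n : ℝ)⁻¹ := h2
      _ ≤ C ^ k * (n : ℝ)⁻¹ := by gcongr; exact le_max_left _ _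
  · refine Nat.le_floor ?_
    push_cast
    linarith
  · push_cast
    -- Half of `L` absorbs the main term; the remaining `exp 1 * C = D / 4` is below `L / 2` because
    -- `3 * D * x ≤ L`.
    have h1 : Real.exp 1 * C * (2 * (L / D)) = L / 2 := by
      rw [← hDe]
      field_simp
      norm_num
    have h2 : Real.exp 1 * C * (2 * (f * g)) ≤ Real.exp 1 * C * (2 * (L / D)) := by gcongr
    nlinarith
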